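/- Let $l\ge 0$ be an integer and let $G$ be a finite simple planar graph that has the $(2l+1)\times(2l+1)$ grid as a minor. Then the diameter of $G$ is at least $l$. Here the $g\times g$ grid is the graph with vertex set $\{1,\dots,g\}^2$ in which $(i,j)$ and $(i',j')$ are adjacent if and only if $|i-i'|+|j-j'|=1$. A graph is planar if it can be drawn in the plane with its vertices as distinct points and its edges as arcs joining their ends, so that no arc contains a vertex other than its ends and two different arcs meet only in common ends. A graph $H$ is a minor of $G$ if there are pairwise disjoint nonempty vertex sets $B_a\subseteq V(G)$, one for each vertex $a$ of $H$, each inducing a connected subgraph of $G$, such that $G$ has an edge between $B_a$ and $B_b$ whenever $ab$ is an edge of $H$. The diameter of $G$ is $\max_{x,y}d(x,y)$, where $d(x,y)$ is the length of a shortest path between $x$ and $y$; it is $\infty$ if $G$ is disconnected. -/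

import Mathlib

namespace PlanarGrid

/-- `A` is an arc in the plane with end points `x` and `y`: the image of an injective path, that is,
of an injective continuous map from the unit interval, going from `x` to `y`. -/
def IsArc (A : Set (EuclideanSpace ℝ (Fin 2))) (x y : EuclideanSpace ℝ (Fin 2)) : Prop :=
  ∃ γ : Path x y, Function.Injective γ ∧ Set.range γ = A

/-- A drawing of the graph `G` in the plane without crossings. Vertices are distinct points, every
edge is an arc between its two ends, and these arcs meet vertices and one another only where they
have to. The value of `arc` at a pair that is not an edge of `G` is irrelevant. -/
structure PlaneDrawing {V : Type*} (G : SimpleGraph V) where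
  /-- The point representing a vertex. -/
  point : V → EuclideanSpace ℝ (Fin 2)
  /-- The set of points of the arc representing an edge. -/
  arc : Sym2 V → Set (EuclideanSpace ℝ (Fin 2))
  /-- Distinct vertices are distinct points. -/
  point_injective : Function.Injective point
  /-- An edge is an arc between its ends. -/
  isArc : ∀ u v : V, G.Adj u v → IsArc (arc s(u, v)) (point u) (point v)
  /-- An edge contains no vertex except its ends. -/
  mem_of_point_mem_arc : ∀ e ∈ G.edgeSet, ∀ w : V, point w ∈ arc e → w ∈ e
  /-- Two different edges meet only in vertices (hence only in common ends). -/
  arc_inter_subset : ∀ e ∈ G.edgeSet, ∀ f ∈ G.edgeSet, e ≠ f → arc e ∩ arc f ⊆ Set.range point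

/-- A graph is planar if it can be drawn in the plane without crossings. -/
def IsPlanar {V : Type*} (G : SimpleGraph V) : Prop :=
  Nonempty (PlaneDrawing G)

/-- `H` is a minor of `G`: there are pairwise disjoint (nonempty) connected branch sets in `G`, one
for each vertex of `H`, such that for every edge of `H` there is an edge of `G` between the two
corresponding branch sets. -/
def IsMinor {W V : Type*} (H : SimpleGraph W) (G : SimpleGraph V) : Prop :=
  ∃ B : W → Set V,
    (∀ a, (G.induce (B a)).Connected) ∧
    (∀ a b, a ≠ b → Disjoint (B a) (B b)) ∧
    (∀ a b, H.Adj a b → ∃ x ∈ B a, ∃ y ∈ B b, G.Adj x y)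

/-- The `g × g` grid, with `g` vertices on each side: the Cartesian product of two paths with `g`
vertices each. -/
def grid (g : ℕ) : SimpleGraph (Fin g × Fin g) :=
  (SimpleGraph.pathGraph g).boxProd (SimpleGraph.pathGraph g)

end PlanarGrid

open Set Topology

/-! Consider the concentric square rings of radius 0, ..., l around the centre of the grid. A walk
in G from the branch set of the centre to that of the middle of the left side meets all l + 1 of
them, so its length is at least l (`IsGridModel.le_length_of_isPlanar`). If it missed a ring
strictly between, then the four sides of that ring, its inside extended by what can be reached from
the centre, and the part of the grid to its left would yield a K₅ minor
(`IsGridModel.exists_mem_support_of_isPlanar`).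

A planar graph has no K₅ minor (`IsPlanar.not_isMinor_top`) because of a parity argument. For
disjoint paths α and β the map α(s) - β(t) has no zero on a simply connected domain, hence has a
continuous square root. Comparing its values at the corners of the unit square gives a relation
between signs for each pair of disjoint edges of K₅, and these relations together multiply to 1 = -1
(`false_of_five_paths`). -/

namespace PlanarGrid

/-! ### Van Kampen's obstruction by complex square roots -/

section SquareRoots

theorem exists_continuous_sq_eq {X : Type*} [TopologicalSpace X] [LocallyPathConnectedSpace X]
    [SimplyConnectedSpace X] {g : X → ℂ} (hg : Continuous g) (h0 : ∀ x, g x ≠ 0) :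
    ∃ f : X → ℂ, Continuous f ∧ ∀ x, f x ^ 2 = g x := by
  obtain ⟨f, hf, h⟩ := Complex.exists_continuousOn_pow_eq (U := (univ : Set X))
    ((Homeomorph.Set.univ X).toHomotopyEquiv.simplyConnectedSpace) isOpen_univ hg.continuousOn
    (by simpa using h0) two_ne_zero
  exact ⟨f, continuousOn_univ.1 hf, h⟩

/-- The ratio of two values of a continuous square root does not depend on the root. -/
theorem div_eq_div_of_sq_eq_sq {X : Type*} [TopologicalSpace X] [PreconnectedSpace X]
    {f g : X → ℂ} (hf : Continuous f) (hg : Continuous g) (h : ∀ x, f x ^ 2 = g x ^ 2)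
    (h0 : ∀ x, g x ≠ 0) (x y : X) : f x / f y = g x / g y := by
  rcases isPreconnected_univ.eq_or_eq_neg_of_sq_eq hf.continuousOn hg.continuousOn
    (fun x _ => h x) (fun {x} _ => h0 x) with H | H
  · rw [H (mem_univ x), H (mem_univ y)]
  · rw [H (mem_univ x), H (mem_univ y)]
    simp [neg_div_neg_eq]

/-- Going around the boundary of the square `[0, 1]²` does not change a continuous square root of
`α s - β t`. -/
theorem sqrt_ratio_mul_eq {α β : ℝ → ℂ} (hα : Continuous α) (hβ : Continuous β)
    (hne : ∀ s t, α s ≠ β t) {a₀ a₁ b₀ b₁ : ℝ → ℂ}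
    (ca₀ : Continuous a₀) (ca₁ : Continuous a₁) (cb₀ : Continuous b₀) (cb₁ : Continuous b₁)
    (ha₀ : ∀ s, a₀ s ^ 2 = α s - β 0) (ha₁ : ∀ s, a₁ s ^ 2 = α s - β 1)
    (hb₀ : ∀ t, b₀ t ^ 2 = β t - α 0) (hb₁ : ∀ t, b₁ t ^ 2 = β t - α 1) :
    (a₀ 1 / a₀ 0) * (b₁ 1 / b₁ 0) = (a₁ 1 / a₁ 0) * (b₀ 1 / b₀ 0) := by
  obtain ⟨H, cH, hH⟩ := exists_continuous_sq_eq (g := fun x : ℝ × ℝ => α x.1 - β x.2)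
    (by fun_prop) (fun x => sub_ne_zero.2 (hne _ _))
  have H0 : ∀ x, H x ≠ 0 := fun x hx => sub_ne_zero.2 (hne x.1 x.2) (by rw [← hH x, hx]; simp)
  have ea : ∀ (a : ℝ → ℂ) (t : ℝ), Continuous a → (∀ s, a s ^ 2 = α s - β t) →
      a 1 / a 0 = H (1, t) / H (0, t) := fun a t ca ha =>
    div_eq_div_of_sq_eq_sq ca (g := fun s => H (s, t)) (by fun_prop)
      (fun s => by rw [ha, hH]) (fun s => H0 _) 1 0
  have eb : ∀ (b : ℝ → ℂ) (s : ℝ), Continuous b → (∀ t, b t ^ 2 = β t - α s) →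
      b 1 / b 0 = H (s, 1) / H (s, 0) := fun b s cb hb => by
    -- The factor `Complex.I` accounts for the opposite sign of β - α; it cancels in the ratio.
    rw [div_eq_div_of_sq_eq_sq cb (g := fun t => Complex.I * H (s, t)) (by fun_prop)
      (fun t => by rw [hb, mul_pow, hH, Complex.I_sq]; ring)
      (fun t => mul_ne_zero Complex.I_ne_zero (H0 _)) 1 0, mul_div_mul_left _ _ Complex.I_ne_zero]
  rw [ea a₀ 0 ca₀ ha₀, ea a₁ 1 ca₁ ha₁, eb b₀ 0 cb₀ hb₀, eb b₁ 1 cb₁ hb₁]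
  have h1 := H0 (0, 0)
  have h2 := H0 (0, 1)
  have h3 := H0 (1, 0)
  field_simp

end SquareRoots

/-- The van Kampen obstruction: five points in the plane cannot be joined pairwise by paths such
that paths without common end points are disjoint. -/
theorem false_of_five_paths {p : Fin 5 → ℂ} (γ : ∀ i j, Path (p i) (p j))
    (hdisj : ∀ i j k l, i ≠ k → i ≠ l → j ≠ k → j ≠ l → ∀ s t, γ i j s ≠ γ k l t) : False := by
  -- The loop `γ i i` starts at `p i`, so the hypothesis on paths also keeps points apart from each
  -- other and from paths.
  have hpne : ∀ i j, i ≠ j → p i ≠ p j := fun i j h => by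
    simpa using hdisj i i j j h h h h 0 0
  have hγne : ∀ v a b, v ≠ a → v ≠ b → ∀ t, (γ a b).extend t - p v ≠ 0 := fun v a b ha hb t => by
    have := hdisj v v a b ha hb ha hb 0 (projIcc 0 1 zero_le_one t)
    rw [sub_ne_zero]
    simpa [Path.extend, IccExtend] using this.symm
  have hroot : ∀ v a b : Fin 5, ∃ h : ℝ → ℂ, v ≠ a → v ≠ b →
      Continuous h ∧ ∀ t, h t ^ 2 = (γ a b).extend t - p v := fun v a b => by
    by_cases h : v ≠ a ∧ v ≠ b
    · obtain ⟨f, hf⟩ := exists_continuous_sq_eq (g := fun t => (γ a b).extend t - p v)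
        (by fun_prop) (hγne v a b h.1 h.2)
      exact ⟨f, fun _ _ => hf⟩
    · exact ⟨0, fun h1 h2 => (h ⟨h1, h2⟩).elim⟩
  choose h hh using hroot
  -- `r i j` is a square root of `p j - p i`
  have hr : ∃ r : Fin 5 → Fin 5 → ℂ, (∀ i j, r i j ^ 2 = p j - p i) ∧
      ∀ i j, i < j → r j i = Complex.I * r i j := by
    choose z hz using fun i j => IsAlgClosed.exists_pow_nat_eq (p j - p i) two_pos
    refine ⟨fun i j => if i < j then z i j else Complex.I * z j i, fun i j => ?_, fun i j hij => ?_⟩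
    · beta_reduce
      split_ifs
      · exact hz i j
      · rw [mul_pow, hz, Complex.I_sq]; ring
    · simp [hij, hij.le]
  obtain ⟨r, hr2, hrI⟩ := hr
  have hr0 : ∀ i j, i ≠ j → r i j ≠ 0 := fun i j hij h0 => by
    have := hr2 i j
    rw [h0, eq_comm, zero_pow two_ne_zero, sub_eq_zero] at this
    exact hpne i j hij this.symm
  -- `ε v a b` is the parity of the turning of `γ a b` around `p v`, measured against the fixed
  -- roots `r`; the value 0 is a dummy for `v` an end.
  have hε : ∀ v a b, ∃ ε : ℂ, v ≠ a → v ≠ b →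
      ε ^ 2 = 1 ∧ h v a b 1 / h v a b 0 = ε * (r v b / r v a) := fun v a b => by
    by_cases hv : v ≠ a ∧ v ≠ b
    · obtain ⟨-, h2⟩ := hh v a b hv.1 hv.2
      have ra := hr0 v a hv.1
      have rb := hr0 v b hv.2
      refine ⟨h v a b 1 / h v a b 0 * (r v a / r v b), fun _ _ => ⟨?_, by field_simp⟩⟩
      rw [mul_pow, div_pow, div_pow, h2, h2, hr2, hr2]
      have h3 := sub_ne_zero.2 (hpne _ _ hv.1.symm)
      have h4 := sub_ne_zero.2 (hpne _ _ hv.2.symm)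
      simp only [Path.extend_zero, Path.extend_one]
      field_simp
    · exact ⟨0, fun h1 h2 => (hv ⟨h1, h2⟩).elim⟩
  choose ε hε using hε
  have hσ : ∃ σ : Fin 5 → Fin 5 → ℂ, (∀ i j, i ≠ j → r i j / r j i = σ i j) ∧
      (∀ i j, i < j → σ i j = -Complex.I) ∧ ∀ i j, i < j → σ j i = Complex.I := by
    refine ⟨fun i j => r i j / r j i, fun _ _ _ => rfl, fun i j hij => ?_, fun i j hij => ?_⟩
    · have := hr0 i j hij.ne
      simp only
      rw [hrI i j hij, div_mul_cancel_right₀ this, Complex.inv_I]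
    · have := hr0 i j hij.ne
      simp only
      rw [hrI i j hij, mul_div_cancel_right₀ _ this]
  obtain ⟨σ, hσ, hlt, hgt⟩ := hσ
  have hε2 : ∀ v a b, v ≠ a → v ≠ b → ε v a b * ε v a b = 1 := fun v a b h1 h2 => by
    rw [← sq, (hε v a b h1 h2).1]
  -- The boundary relation for `γ u v` and `γ w x`: the fixed roots combine into the ratios `σ`, and
  -- signs change sides because they square to 1.
  have key : ∀ u v w x, u ≠ w → u ≠ x → v ≠ w → v ≠ x →
      ε w u v * ε v w x * (ε x u v * ε u w x) * (σ w v * σ v x * (σ x u * σ u w)) = 1 :=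
    fun u v w x h1 h2 h3 h4 => by
    have H := sqrt_ratio_mul_eq (γ u v).continuous_extend (γ w x).continuous_extend
      (fun s t => by simpa [Path.extend, IccExtend] using hdisj u v w x h1 h2 h3 h4 _ _)
      (hh w u v h1.symm h3.symm).1 (hh x u v h2.symm h4.symm).1
      (hh u w x h1 h2).1 (hh v w x h3 h4).1
      (by simpa using (hh w u v h1.symm h3.symm).2) (by simpa using (hh x u v h2.symm h4.symm).2)
      (by simpa using (hh u w x h1 h2).2) (by simpa using (hh v w x h3 h4).2)
    rw [(hε w u v h1.symm h3.symm).2, (hε x u v h2.symm h4.symm).2, (hε u w x h1 h2).2,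
      (hε v w x h3 h4).2] at H
    rw [← hσ _ _ h3.symm, ← hσ _ _ h4, ← hσ _ _ h2.symm, ← hσ _ _ h1]
    have n1 := hr0 _ _ h1
    have n2 := hr0 _ _ h2
    have n3 := hr0 _ _ h3
    have n4 := hr0 _ _ h4
    have n5 := hr0 _ _ h1.symm
    have n6 := hr0 _ _ h2.symm
    have n7 := hr0 _ _ h3.symm
    have n8 := hr0 _ _ h4.symm
    have e := hε2 x u v h2.symm h4.symm
    have e' := hε2 u w x h1 h2
    have H' : ε w u v * ε v w x * (r w v / r v w * (r v x / r x v) * (r x u / r u x *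
        (r u w / r w u))) = ε x u v * ε u w x := by
      field_simp at H ⊢
      linear_combination H
    linear_combination (ε x u v * ε u w x) * H' + e * ε u w x * ε u w x + e'
  have I4 : Complex.I * Complex.I * (Complex.I * Complex.I) = 1 := by simp
  -- in convex position two of the paths cross if and only if their ends alternate
  have alternate : ∀ u w v x, u < w → w < v → v < x →
      ε w u v * ε v w x * (ε x u v * ε u w x) = -1 := fun u w v x h1 h2 h3 => by
    have k := key u v w x h1.ne (h1.trans (h2.trans h3)).ne h2.ne' h3.ne
    rw [hlt u w h1, hlt w v h2, hlt v x h3, hgt u x (h1.trans (h2.trans h3))] at k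
    linear_combination -k - (ε w u v * ε v w x * (ε x u v * ε u w x)) * I4
  have separate : ∀ u v w x, u < v → v < w → w < x →
      ε w u v * ε v w x * (ε x u v * ε u w x) = 1 := fun u v w x h1 h2 h3 => by
    have k := key u v w x (h1.trans h2).ne (h1.trans (h2.trans h3)).ne h2.ne (h2.trans h3).ne
    rw [hlt u w (h1.trans h2), hgt v w h2, hlt v x (h2.trans h3),
      hgt u x (h1.trans (h2.trans h3))] at k
    linear_combination k - (ε w u v * ε v w x * (ε x u v * ε u w x)) * I4
  have nested : ∀ u w x v, u < w → w < x → x < v →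
      ε w u v * ε v w x * (ε x u v * ε u w x) = 1 := fun u w x v h1 h2 h3 => by
    have k := key u v w x h1.ne (h1.trans h2).ne (h2.trans h3).ne' h3.ne'
    rw [hlt u w h1, hlt w v (h2.trans h3), hgt x v h3, hgt u x (h1.trans h2)] at k
    linear_combination k - (ε w u v * ε v w x * (ε x u v * ε u w x)) * I4
  -- Four points give three pairs of disjoint edges, with four signs each. These twelve signs
  -- regroup by the triples of the four points, and exactly one of the three pairs alternates.
  obtain ⟨T, hT⟩ : ∃ T : Fin 5 → Fin 5 → Fin 5 → ℂ,
      ∀ a b c, T a b c = ε a b c * ε b a c * ε c a b := ⟨_, fun _ _ _ => rfl⟩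
  have hT2 : ∀ a b c, a < b → b < c → T a b c * T a b c = 1 := fun a b c h1 h2 => by
    have e1 := hε2 a b c h1.ne (h1.trans h2).ne
    have e2 := hε2 b a c h1.ne' h2.ne
    have e3 := hε2 c a b (h1.trans h2).ne' h2.ne'
    rw [hT]
    linear_combination (ε b a c * ε b a c * (ε c a b * ε c a b)) * e1 +
      (ε c a b * ε c a b) * e2 + e3
  have hT4 : ∀ a b c d : Fin 5, a < b → b < c → c < d →
      T a b c * T a b d * T a c d * T b c d = -1 := fun u w v x h1 h2 h3 => by
    calc _ = (ε w u v * ε v w x * (ε x u v * ε u w x)) * (ε v u w * ε w v x * (ε x u w * ε u v x)) *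
        (ε w u x * ε x w v * (ε v u x * ε u w v)) := by simp only [hT]; ring
      _ = -1 := by
        rw [alternate u w v x h1 h2 h3, separate u w v x h1 h2 h3,
          show ε w u x * ε x w v * (ε v u x * ε u w v) = 1 by
            linear_combination nested u w v x h1 h2 h3]
        simp
  -- Each triple lies in two of the five quadruples, so every `T` occurs twice in a product of five
  -- factors -1.
  have P : (T 0 1 2 * T 0 1 3 * T 0 2 3 * T 1 2 3) * (T 0 1 2 * T 0 1 4 * T 0 2 4 * T 1 2 4) *
      (T 0 1 3 * T 0 1 4 * T 0 3 4 * T 1 3 4) * (T 0 2 3 * T 0 2 4 * T 0 3 4 * T 2 3 4) *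
      (T 1 2 3 * T 1 2 4 * T 1 3 4 * T 2 3 4) = -1 := by
    rw [hT4 0 1 2 3, hT4 0 1 2 4, hT4 0 1 3 4, hT4 0 2 3 4, hT4 1 2 3 4] <;> first | decide | norm_num
  have Q : (T 0 1 2 * T 0 1 2) * (T 0 1 3 * T 0 1 3) * (T 0 1 4 * T 0 1 4) * (T 0 2 3 * T 0 2 3) *
      (T 0 2 4 * T 0 2 4) * (T 0 3 4 * T 0 3 4) * (T 1 2 3 * T 1 2 3) * (T 1 2 4 * T 1 2 4) *
      (T 1 3 4 * T 1 3 4) * (T 2 3 4 * T 2 3 4) = 1 := by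
    rw [hT2 0 1 2, hT2 0 1 3, hT2 0 1 4, hT2 0 2 3, hT2 0 2 4, hT2 0 3 4, hT2 1 2 3, hT2 1 2 4,
      hT2 1 3 4, hT2 2 3 4] <;> first | decide | norm_num
  have : (1 : ℂ) = -1 := by rw [← P, ← Q]; ring
  norm_num at this

/-! ### Planar graphs have no K₅ minor -/

namespace PlaneDrawing

variable {V : Type*} {G : SimpleGraph V} (D : PlaneDrawing G)

/-- The part of the plane covered by the drawing of the subgraph induced by `U`. -/
def region (U : Set V) : Set (EuclideanSpace ℝ (Fin 2)) :=
  D.point '' U ∪ ⋃ (u ∈ U) (v ∈ U) (_ : G.Adj u v), D.arc s(u, v)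

theorem point_mem_region {U : Set V} {u : V} (hu : u ∈ U) : D.point u ∈ D.region U :=
  Or.inl ⟨u, hu, rfl⟩

theorem mem_of_point_mem_region {U : Set V} {w : V} (h : D.point w ∈ D.region U) : w ∈ U := by
  rcases h with ⟨u, hu, huw⟩ | hz
  · exact D.point_injective huw ▸ hu
  · simp only [mem_iUnion] at hz
    obtain ⟨u, hu, v, hv, huv, hz⟩ := hz
    rcases Sym2.mem_iff.1 (D.mem_of_point_mem_arc _ huv w hz) with rfl | rfl
    exacts [hu, hv]

/-- An edge inside `U` differs from an edge inside `U'`, so a common point of the regions is always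
a vertex, and this vertex would lie in both sets. -/
theorem disjoint_region {U U' : Set V} (h : Disjoint U U') :
    Disjoint (D.region U) (D.region U') := by
  have hpt : ∀ w, D.point w ∈ D.region U → D.point w ∈ D.region U' → False := fun w h1 h2 =>
    disjoint_left.1 h (D.mem_of_point_mem_region h1) (D.mem_of_point_mem_region h2)
  refine disjoint_left.2 fun z hz hz' => ?_
  suffices ∃ w, D.point w = z by
    obtain ⟨w, rfl⟩ := this
    exact hpt w hz hz'
  rcases id hz with ⟨u, hu, rfl⟩ | ha
  · exact ⟨u, rfl⟩
  rcases id hz' with ⟨u, hu, rfl⟩ | hb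
  · exact ⟨u, rfl⟩
  simp only [mem_iUnion] at ha hb
  obtain ⟨u, hu, v, hv, huv, ha⟩ := ha
  obtain ⟨x, hx, y, hy, hxy, hb⟩ := hb
  refine D.arc_inter_subset s(u, v) huv s(x, y) hxy (fun heq => ?_) ⟨ha, hb⟩
  have hmem : u ∈ s(x, y) := heq ▸ Sym2.mem_mk_left u v
  rcases Sym2.mem_iff.1 hmem with rfl | rfl
  exacts [disjoint_left.1 h hu hx, disjoint_left.1 h hu hy]

theorem joinedIn_region_of_adj {U : Set V} {u v : V} (hu : u ∈ U) (hv : v ∈ U) (h : G.Adj u v) :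
    JoinedIn (D.region U) (D.point u) (D.point v) := by
  obtain ⟨γ, -, hγ⟩ := D.isArc u v h
  refine ⟨γ, fun t => Or.inr ?_⟩
  simp only [mem_iUnion]
  exact ⟨u, hu, v, hv, h, hγ ▸ mem_range_self t⟩

theorem joinedIn_region_of_reachable {U : Set V} {u v : U} (h : (G.induce U).Reachable u v) :
    JoinedIn (D.region U) (D.point u) (D.point v) := by
  obtain ⟨w⟩ := h
  induction w with
  | nil => exact JoinedIn.refl (D.point_mem_region (Subtype.coe_prop _))
  | cons hadj _ ih =>
    exact (D.joinedIn_region_of_adj (Subtype.coe_prop _) (Subtype.coe_prop _) hadj).trans ih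

end PlaneDrawing

/-- A planar graph does not have the complete graph on five vertices as a minor. -/
theorem IsPlanar.not_isMinor_top {V : Type*} {G : SimpleGraph V} (hG : IsPlanar G) :
    ¬ IsMinor (⊤ : SimpleGraph (Fin 5)) G := by
  rintro ⟨B, hconn, hdisj, hadj⟩
  obtain ⟨D⟩ := hG
  obtain ⟨c⟩ : Nonempty (∀ i, B i) := ⟨fun i => (hconn i).nonempty.some⟩
  have hJ : ∀ i j, JoinedIn (D.region (B i ∪ B j)) (D.point (c i)) (D.point (c j)) := fun i j => by
    have hc : (G.induce (B i ∪ B j)).Connected := by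
      by_cases hij : i = j
      · subst hij
        rw [union_self]
        exact hconn i
      · obtain ⟨x, hx, y, hy, hxy⟩ := hadj i j (by simpa using hij)
        exact SimpleGraph.connected_induce_union (hconn i).preconnected (hconn j).preconnected
          hx hy hxy
    exact D.joinedIn_region_of_reachable
      (hc.preconnected ⟨c i, Or.inl (c i).2⟩ ⟨c j, Or.inr (c j).2⟩)
  choose γ hγ using hJ
  let e := Complex.orthonormalBasisOneI.repr.symm
  refine false_of_five_paths (fun i j => (γ i j).map e.continuous) fun i j k l h1 h2 h3 h4 s t h => ?_
  have hst : γ i j s = γ k l t := e.injective h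
  have hd : Disjoint (B i ∪ B j) (B k ∪ B l) := by
    simp only [disjoint_union_left, disjoint_union_right]
    exact ⟨⟨hdisj _ _ h1, hdisj _ _ h3⟩, hdisj _ _ h2, hdisj _ _ h4⟩
  exact disjoint_left.1 (D.disjoint_region hd) (hγ i j s) (hst ▸ hγ k l t)

/-! ### Grid models and their rectangles -/

variable {V : Type*} {G : SimpleGraph V}

theorem isMinor_top_of_lt {W : Type*} [LinearOrder W] (X : W → Set V)
    (hconn : ∀ a, (G.induce (X a)).Connected) (hdisj : ∀ a b, a < b → Disjoint (X a) (X b))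
    (hadj : ∀ a b, a < b → ∃ x ∈ X a, ∃ y ∈ X b, G.Adj x y) :
    IsMinor (⊤ : SimpleGraph W) G := by
  refine ⟨X, hconn, fun a b hab => ?_, fun a b hab => ?_⟩
  · rcases lt_or_gt_of_ne hab with h | h
    exacts [hdisj a b h, (hdisj b a h).symm]
  · rcases lt_or_gt_of_ne hab.ne with h | h
    · exact hadj a b h
    · obtain ⟨x, hx, y, hy, hxy⟩ := hadj b a h
      exact ⟨y, hy, x, hx, hxy.symm⟩

theorem connected_induce_iUnion_Icc {S : ℕ → Set V} {a b : ℕ} (hab : a ≤ b)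
    (hconn : ∀ i, a ≤ i → i ≤ b → (G.induce (S i)).Connected)
    (hadj : ∀ i, a ≤ i → i < b → ∃ x ∈ S i, ∃ y ∈ S (i + 1), G.Adj x y) :
    (G.induce (⋃ i ∈ Icc a b, S i)).Connected := by
  induction b, hab using Nat.le_induction with
  | base =>
    have hset : ⋃ i ∈ Icc a a, S i = S a := by simp
    exact hset ▸ hconn a le_rfl le_rfl
  | succ b hab ih =>
    have hset : ⋃ i ∈ Icc a (b + 1), S i = (⋃ i ∈ Icc a b, S i) ∪ S (b + 1) := by
      rw [← Order.succ_eq_add_one, ← insert_Icc_right_eq_Icc_succ (by simp; omega)]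
      simp [union_comm]
    rw [hset]
    obtain ⟨x, hx, y, hy, hxy⟩ := hadj b hab (by omega)
    exact SimpleGraph.connected_induce_union
      (ih (fun i h1 h2 => hconn i h1 (by omega)) fun i h1 h2 => hadj i h1 (by omega)).preconnected
      (hconn (b + 1) (by omega) le_rfl).preconnected
      (mem_biUnion (right_mem_Icc.2 hab) hx) hy hxy

/-- The sets `B i j` with `i, j < g` are the branch sets of a `g × g` grid in `G`. -/
structure IsGridModel (G : SimpleGraph V) (g : ℕ) (B : ℕ → ℕ → Set V) : Prop where
  connected : ∀ i j, i < g → j < g → (G.induce (B i j)).Connected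
  eq_of_mem : ∀ i j i' j' v, v ∈ B i j → v ∈ B i' j' → i = i' ∧ j = j'
  adj_right : ∀ i j, i < g → j + 1 < g → ∃ x ∈ B i j, ∃ y ∈ B i (j + 1), G.Adj x y
  adj_down : ∀ i j, i + 1 < g → j < g → ∃ x ∈ B i j, ∃ y ∈ B (i + 1) j, G.Adj x y

theorem IsMinor.exists_isGridModel {g : ℕ} (h : IsMinor (grid g) G) :
    ∃ B, IsGridModel G g B := by
  obtain ⟨B, hconn, hdisj, hadj⟩ := h
  -- Positions outside the grid get the empty set, so disjointness needs no bounds on the indices.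
  refine ⟨fun i j => {v | ∃ (hi : i < g) (hj : j < g), v ∈ B (⟨i, hi⟩, ⟨j, hj⟩)}, ?_, ?_, ?_, ?_⟩
  · intro i j hi hj
    convert! hconn (⟨i, hi⟩, ⟨j, hj⟩) using 2 <;> simp [hi, hj]
  · rintro i j i' j' v ⟨hi, hj, hv⟩ ⟨hi', hj', hv'⟩
    by_contra hne
    refine disjoint_left.1 (hdisj _ _ fun heq => hne ?_) hv hv'
    simpa using heq
  · intro i j hi hj
    obtain ⟨x, hx, y, hy, hxy⟩ := hadj (⟨i, hi⟩, ⟨j, by omega⟩) (⟨i, hi⟩, ⟨j + 1, hj⟩) <| by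
      simp [grid, SimpleGraph.boxProd_adj, SimpleGraph.pathGraph_adj]
    exact ⟨x, ⟨hi, by omega, hx⟩, y, ⟨hi, hj, hy⟩, hxy⟩
  · intro i j hi hj
    obtain ⟨x, hx, y, hy, hxy⟩ := hadj (⟨i, by omega⟩, ⟨j, hj⟩) (⟨i + 1, hi⟩, ⟨j, hj⟩) <| by
      simp [grid, SimpleGraph.boxProd_adj, SimpleGraph.pathGraph_adj]
    exact ⟨x, ⟨by omega, hj, hx⟩, y, ⟨hi, hj, hy⟩, hxy⟩

/-- The union of the sets `B i j` over a rectangle of indices. -/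
def rect (B : ℕ → ℕ → Set V) (a b c d : ℕ) : Set V :=
  ⋃ i ∈ Icc a b, ⋃ j ∈ Icc c d, B i j

theorem mem_rect {B : ℕ → ℕ → Set V} {a b c d : ℕ} {v : V} :
    v ∈ rect B a b c d ↔ ∃ i j, (a ≤ i ∧ i ≤ b ∧ c ≤ j ∧ j ≤ d) ∧ v ∈ B i j := by
  simp only [rect, mem_iUnion, mem_Icc, exists_prop]
  constructor
  · rintro ⟨i, hi, j, hj, hv⟩
    exact ⟨i, j, ⟨hi.1, hi.2, hj⟩, hv⟩
  · rintro ⟨i, j, h, hv⟩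
    exact ⟨i, ⟨h.1, h.2.1⟩, j, h.2.2, hv⟩

namespace IsGridModel

variable {g : ℕ} {B : ℕ → ℕ → Set V}

theorem connected_rect (hB : IsGridModel G g B) {a b c d : ℕ} (hab : a ≤ b)
    (hb : b < g) (hcd : c ≤ d) (hd : d < g) :
    (G.induce (rect B a b c d)).Connected := by
  refine connected_induce_iUnion_Icc hab (fun i h1 h2 => ?_) fun i h1 h2 => ?_
  · exact connected_induce_iUnion_Icc hcd
      (fun j h3 h4 => hB.connected i j (by omega) (by omega))
      fun j h3 h4 => hB.adj_right i j (by omega) (by omega)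
  · obtain ⟨x, hx, y, hy, hxy⟩ := hB.adj_down i c (by omega) (by omega)
    exact ⟨x, mem_biUnion (left_mem_Icc.2 hcd) hx, y, mem_biUnion (left_mem_Icc.2 hcd) hy, hxy⟩

theorem disjoint_rect (hB : IsGridModel G g B) {a b c d a' b' c' d' : ℕ}
    (h : b < a' ∨ b' < a ∨ d < c' ∨ d' < c) :
    Disjoint (rect B a b c d) (rect B a' b' c' d') := by
  refine disjoint_left.2 fun v hv hv' => ?_
  obtain ⟨i, j, hij, hv⟩ := mem_rect.1 hv
  obtain ⟨i', j', hij', hv'⟩ := mem_rect.1 hv'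
  have := hB.eq_of_mem _ _ _ _ v hv hv'
  omega

/-- Two rectangles are joined by an edge if they contain neighbouring positions. -/
theorem adj_rect (hB : IsGridModel G g B) {a b c d a' b' c' d' : ℕ} (i j i' j' : ℕ)
    (h : a ≤ i ∧ i ≤ b ∧ c ≤ j ∧ j ≤ d) (h' : a' ≤ i' ∧ i' ≤ b' ∧ c' ≤ j' ∧ j' ≤ d')
    (hg : i < g ∧ j < g ∧ i' < g ∧ j' < g)
    (hn : i = i' ∧ (j + 1 = j' ∨ j' + 1 = j) ∨ j = j' ∧ (i + 1 = i' ∨ i' + 1 = i)) :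
    ∃ x ∈ rect B a b c d, ∃ y ∈ rect B a' b' c' d', G.Adj x y := by
  suffices ∃ x ∈ B i j, ∃ y ∈ B i' j', G.Adj x y by
    obtain ⟨x, hx, y, hy, hxy⟩ := this
    exact ⟨x, mem_rect.2 ⟨i, j, h, hx⟩, y, mem_rect.2 ⟨i', j', h', hy⟩, hxy⟩
  rcases hn with ⟨rfl, rfl | rfl⟩ | ⟨rfl, rfl | rfl⟩
  · exact hB.adj_right i j hg.1 hg.2.2.2
  · obtain ⟨x, hx, y, hy, hxy⟩ := hB.adj_right i j' hg.1 hg.2.1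
    exact ⟨y, hy, x, hx, hxy.symm⟩
  · exact hB.adj_down i j hg.2.2.1 hg.2.1
  · obtain ⟨x, hx, y, hy, hxy⟩ := hB.adj_down i' j hg.1 hg.2.1
    exact ⟨y, hy, x, hx, hxy.symm⟩

end IsGridModel

/-! ### Rings of the grid as separators -/

/-- The vertices that can be reached from `x` inside `K`. -/
def reachIn (G : SimpleGraph V) (K : Set V) (x : V) : Set V :=
  {z | ∃ p : G.Walk x z, ∀ v ∈ p.support, v ∈ K}

theorem reachIn_subset (K : Set V) (x : V) : reachIn G K x ⊆ K :=
  fun _ ⟨p, hp⟩ => hp _ p.end_mem_support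

theorem mem_reachIn_self {K : Set V} {x : V} (hx : x ∈ K) : x ∈ reachIn G K x :=
  ⟨.nil, by simpa using hx⟩

theorem connected_reachIn {K : Set V} {x : V} (hx : x ∈ K) :
    (G.induce (reachIn G K x)).Connected := by
  classical
  refine G.induce_connected_of_patches x (mem_reachIn_self hx) ?_
  rintro v ⟨p, hp⟩
  refine ⟨{v | v ∈ p.support}, fun z hz => ⟨p.takeUntil z hz, fun u hu => hp u ?_⟩,
    p.start_mem_support, p.end_mem_support, p.connected_induce_support.preconnected _ _⟩
  exact p.support_takeUntil_subset_support hz hu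

theorem reachIn_of_adj {K : Set V} {x z z' : V} (hz : z ∈ reachIn G K x) (h : G.Adj z z')
    (hz' : z' ∈ K) : z' ∈ reachIn G K x := by
  obtain ⟨p, hp⟩ := hz
  refine ⟨p.concat h, fun v hv => ?_⟩
  rw [SimpleGraph.Walk.support_concat] at hv
  simp only [List.mem_append, List.mem_singleton] at hv
  rcases hv with hv | rfl
  exacts [hp v hv, hz']

/-- In a planar graph with a grid model, every walk from the centre of a square subgrid to the part
of the grid left of the square meets the boundary of the square. -/
theorem IsGridModel.exists_mem_support_of_isPlanar {g : ℕ} {B : ℕ → ℕ → Set V}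
    (hB : IsGridModel G g B) (hG : IsPlanar G) {m k : ℕ} (hm : 0 < m) (hk : 0 < k)
    (hg : m + 2 * k < g) {x y : V} (hx : x ∈ B (m + k) (m + k)) (hy : y ∈ B (m + k) 0)
    (w : G.Walk x y) :
    ∃ v ∈ w.support, ∃ i j, (m ≤ i ∧ i ≤ m + 2 * k ∧ m ≤ j ∧ j ≤ m + 2 * k ∧
      (i = m ∨ i = m + 2 * k ∨ j = m ∨ j = m + 2 * k)) ∧ v ∈ B i j := by
  by_contra! hw
  obtain ⟨n, hn⟩ : ∃ n, n = m + 2 * k := ⟨_, rfl⟩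
  rw [← hn] at hw hg
  -- `I` is the inside of the square and `O` lies to its left. The ring is cut into four sides with
  -- all corners in `T` and `D`, so that `O` touches `L`, `T` and `D`. With `D` and `R` merged, only
  -- the edge between `I` and `O` is missing from a K₅.
  set I := rect B (m + 1) (n - 1) (m + 1) (n - 1)
  set O := rect B m n 0 (m - 1)
  set L := rect B (m + 1) (n - 1) m m
  set T := rect B m m m n
  set D := rect B n n m n
  set R := rect B (m + 1) (n - 1) n n
  set K := (O ∪ L ∪ T ∪ (D ∪ R))ᶜ
  have hIx : x ∈ I := mem_rect.2 ⟨_, _, by omega, hx⟩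
  have hOy : y ∈ O := mem_rect.2 ⟨_, _, by omega, hy⟩
  have hIK : Disjoint I (O ∪ L ∪ T ∪ (D ∪ R)) := by
    simp only [disjoint_union_right]
    refine ⟨⟨⟨?_, ?_⟩, ?_⟩, ?_, ?_⟩ <;> exact hB.disjoint_rect (by omega)
  have hxK : x ∈ K := fun h => disjoint_left.1 hIK hIx h
  have hAK : Disjoint (reachIn G K x ∪ I) (O ∪ L ∪ T ∪ (D ∪ R)) :=
    disjoint_union_left.2 ⟨disjoint_left.2 fun v hv => reachIn_subset K x hv, hIK⟩
  -- The walk must leave the part reachable in `K`, and the vertex where it does so is outside `K`.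
  -- The walk avoids the ring, so this vertex is in `O`.
  have hedge : ∃ z ∈ reachIn G K x, ∃ z' ∈ O, G.Adj z z' := by
    obtain ⟨d, hd, h1, h2⟩ := w.exists_boundary_dart (reachIn G K x) (mem_reachIn_self hxK)
      fun h => reachIn_subset K x h (by simp [hOy])
    refine ⟨d.fst, h1, d.snd, ?_, d.adj⟩
    by_contra hO
    refine h2 (reachIn_of_adj h1 d.adj fun h => ?_)
    have hs := w.dart_snd_mem_support_of_mem_darts hd
    rcases h with ((h | h) | h) | h | h
    · exact hO h
    all_goals
      obtain ⟨i, j, hij, hv⟩ := mem_rect.1 h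
      exact hw _ hs i j (by omega) hv
  have union_left : ∀ {P Q S : Set V}, (∃ x ∈ Q, ∃ y ∈ S, G.Adj x y) →
      ∃ x ∈ P ∪ Q, ∃ y ∈ S, G.Adj x y :=
    fun ⟨x, hx, h⟩ => ⟨x, Or.inr hx, h⟩
  have union_right₁ : ∀ {P Q S : Set V}, (∃ x ∈ S, ∃ y ∈ P, G.Adj x y) →
      ∃ x ∈ S, ∃ y ∈ P ∪ Q, G.Adj x y :=
    fun ⟨x, hx, y, hy, h⟩ => ⟨x, hx, y, Or.inl hy, h⟩
  have union_right₂ : ∀ {P Q S : Set V}, (∃ x ∈ S, ∃ y ∈ Q, G.Adj x y) →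
      ∃ x ∈ S, ∃ y ∈ P ∪ Q, G.Adj x y :=
    fun ⟨x, hx, y, hy, h⟩ => ⟨x, hx, y, Or.inr hy, h⟩
  refine hG.not_isMinor_top (isMinor_top_of_lt ![reachIn G K x ∪ I, O, L, T, D ∪ R] ?_ ?_ ?_)
  · have hA : (G.induce (reachIn G K x ∪ I)).Connected :=
      SimpleGraph.induce_union_connected (connected_reachIn hxK).preconnected
        (hB.connected_rect (by omega) (by omega) (by omega) (by omega)).preconnected
        ⟨x, mem_reachIn_self hxK, hIx⟩
    have hDR : (G.induce (D ∪ R)).Connected := by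
      obtain ⟨u, hu, v, hv, huv⟩ : ∃ u ∈ D, ∃ v ∈ R, G.Adj u v :=
        hB.adj_rect n n (n - 1) n (by omega) (by omega) (by omega) (by omega)
      exact SimpleGraph.connected_induce_union
        (hB.connected_rect (by omega) (by omega) (by omega) (by omega)).preconnected
        (hB.connected_rect (by omega) (by omega) (by omega) (by omega)).preconnected hu hv huv
    simp only [Fin.forall_fin_succ, Matrix.cons_val]
    refine ⟨hA, ?_, ?_, ?_, hDR, by simp⟩ <;>
      exact hB.connected_rect (by omega) (by omega) (by omega) (by omega)
  · simp only [disjoint_union_right] at hAK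
    obtain ⟨⟨⟨a1, a2⟩, a3⟩, a4, a5⟩ := hAK
    have hdisj : Disjoint O L ∧ Disjoint O T ∧ Disjoint O D ∧ Disjoint O R ∧ Disjoint L T ∧
        Disjoint L D ∧ Disjoint L R ∧ Disjoint T D ∧ Disjoint T R := by
      refine ⟨?_, ?_, ?_, ?_, ?_, ?_, ?_, ?_, ?_⟩ <;> exact hB.disjoint_rect (by omega)
    simp only [Fin.forall_fin_succ, Matrix.cons_val]
    simp [*, Fin.lt_def]
  · have hIL : ∃ u ∈ I, ∃ v ∈ L, G.Adj u v :=
      hB.adj_rect (m + k) (m + 1) (m + k) m (by omega) (by omega) (by omega) (by omega)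
    have hIT : ∃ u ∈ I, ∃ v ∈ T, G.Adj u v :=
      hB.adj_rect (m + 1) (m + k) m (m + k) (by omega) (by omega) (by omega) (by omega)
    have hIR : ∃ u ∈ I, ∃ v ∈ R, G.Adj u v :=
      hB.adj_rect (m + k) (n - 1) (m + k) n (by omega) (by omega) (by omega) (by omega)
    have hOL : ∃ u ∈ O, ∃ v ∈ L, G.Adj u v :=
      hB.adj_rect (m + k) (m - 1) (m + k) m (by omega) (by omega) (by omega) (by omega)
    have hOT : ∃ u ∈ O, ∃ v ∈ T, G.Adj u v :=
      hB.adj_rect m (m - 1) m m (by omega) (by omega) (by omega) (by omega)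
    have hOD : ∃ u ∈ O, ∃ v ∈ D, G.Adj u v :=
      hB.adj_rect n (m - 1) n m (by omega) (by omega) (by omega) (by omega)
    have hLT : ∃ u ∈ L, ∃ v ∈ T, G.Adj u v :=
      hB.adj_rect (m + 1) m m m (by omega) (by omega) (by omega) (by omega)
    have hLD : ∃ u ∈ L, ∃ v ∈ D, G.Adj u v :=
      hB.adj_rect (n - 1) m n m (by omega) (by omega) (by omega) (by omega)
    have hTR : ∃ u ∈ T, ∃ v ∈ R, G.Adj u v :=
      hB.adj_rect m n (m + 1) n (by omega) (by omega) (by omega) (by omega)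
    obtain ⟨z, hz, z', hz', hzz⟩ := hedge
    have e01 : ∃ u ∈ reachIn G K x ∪ I, ∃ v ∈ O, G.Adj u v := ⟨z, Or.inl hz, z', hz', hzz⟩
    have key : ∀ a b : Fin 5, a < b →
        (a = 0 ∧ b = 1) ∨ (a = 0 ∧ b = 2) ∨ (a = 0 ∧ b = 3) ∨ (a = 0 ∧ b = 4) ∨
        (a = 1 ∧ b = 2) ∨ (a = 1 ∧ b = 3) ∨ (a = 1 ∧ b = 4) ∨ (a = 2 ∧ b = 3) ∨
        (a = 2 ∧ b = 4) ∨ (a = 3 ∧ b = 4) := by decide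
    intro a b hab
    rcases key a b hab with ⟨rfl, rfl⟩ | ⟨rfl, rfl⟩ | ⟨rfl, rfl⟩ | ⟨rfl, rfl⟩ | ⟨rfl, rfl⟩ |
      ⟨rfl, rfl⟩ | ⟨rfl, rfl⟩ | ⟨rfl, rfl⟩ | ⟨rfl, rfl⟩ | ⟨rfl, rfl⟩
    exacts [e01, union_left hIL, union_left hIT, union_left (union_right₂ hIR), hOL, hOT,
      union_right₁ hOD, hLT, union_right₁ hLD, union_right₂ hTR]

/-- A walk from the centre of a grid model in a planar graph to the middle of its left side is at
least as long as in the grid. -/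
theorem IsGridModel.le_length_of_isPlanar {l : ℕ} {B : ℕ → ℕ → Set V}
    (hB : IsGridModel G (2 * l + 1) B) (hG : IsPlanar G) {x y : V} (hx : x ∈ B l l)
    (hy : y ∈ B l 0) (w : G.Walk x y) : l ≤ w.length := by
  classical
  -- The ring of radius `k`, written with sums to avoid truncated subtraction. The extreme radii are
  -- met by `x` and `y` themselves; there the separation result does not apply.
  have hring : ∀ k : Fin (l + 1), ∃ v ∈ w.support, ∃ i j, (l ≤ i + k ∧ i ≤ l + k ∧ l ≤ j + k ∧
      j ≤ l + k ∧ (i + k = l ∨ i = l + k ∨ j + k = l ∨ j = l + k)) ∧ v ∈ B i j := by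
    rintro ⟨k, hk⟩
    rcases Nat.eq_zero_or_pos k with rfl | hk0
    · exact ⟨x, w.start_mem_support, l, l, by simp, hx⟩
    rcases (Nat.lt_succ_iff.1 hk).eq_or_lt with rfl | hkl
    · exact ⟨y, w.end_mem_support, k, 0, by simp, hy⟩
    have hml : l - k + k = l := by omega
    obtain ⟨v, hv, i, j, hij, hvB⟩ := hB.exists_mem_support_of_isPlanar hG (m := l - k) (k := k)
      (by omega) hk0 (by omega) (by rwa [hml]) (by rwa [hml]) w
    exact ⟨v, hv, i, j, by dsimp only; omega, hvB⟩
  choose f hf i j hij hfB using hring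
  -- A vertex determines its grid position, whose maximum-norm distance from the centre is the
  -- radius.
  have hinj : Function.Injective f := fun k k' h => by
    have h1 := hB.eq_of_mem _ _ _ _ _ (hfB k) (h ▸ hfB k')
    have h2 := hij k
    have h3 := hij k'
    ext
    omega
  have hcard : Fintype.card (Fin (l + 1)) ≤ w.support.toFinset.card := by
    rw [← Finset.card_univ]
    exact Finset.card_le_card_of_injOn f (fun k _ => by simpa using hf k) hinj.injOn
  have := hcard.trans w.support.toFinset_card_le
  rw [Fintype.card_fin, SimpleGraph.Walk.length_support] at this
  omega

end PlanarGrid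

theorem mainTheorem5 {V : Type*} [Finite V] (G : SimpleGraph V) (l : ℕ)
    (hplanar : PlanarGrid.IsPlanar G)
    (hminor : PlanarGrid.IsMinor (PlanarGrid.grid (2 * l + 1)) G) :
    (l : ℕ∞) ≤ G.ediam := by
  obtain ⟨B, hB⟩ := hminor.exists_isGridModel
  obtain ⟨x, hx⟩ := (hB.connected l l (by omega) (by omega)).nonempty
  obtain ⟨y, hy⟩ := (hB.connected l 0 (by omega) (by omega)).nonempty
  -- The extended distance is an infimum over walks, so no separate case is needed when there is
  -- none.
  refine le_trans (le_iInf fun w => ?_) (SimpleGraph.edist_le_ediam (u := x) (v := y))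
  exact_mod_cast hB.le_length_of_isPlanar hplanar hx hy w
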